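/- For a finite additive group $G$ of order $n$ put $G^*=G\setminus\{0\}$; for $D\subseteq G$ let $\Delta(D)$ be the multiset $\{x-y : x\neq y\in D\}$, and for disjoint $D_1,D_2$ let $\Delta(D_1,D_2)$ be the multiset $\{x-y : x\in D_1, y\in D_2\}$. A $k$-subset $D$ is an $(n,k,\lambda)$-difference set if $\Delta(D)=\lambda G^*$ ($\lambda$ copies of each element of $G^*$). Let $\mathcal{S}'=\{D_1,\dots,D_m\}$ be a family of $m$ pairwise disjoint $k$-subsets of $G$ with union $S$, and put $\mathrm{Int}(\mathcal{S}')=\bigcup_i\Delta(D_i)$ and $\mathrm{Ext}(\mathcal{S}')=\bigcup_{i\ne j}\Delta(D_i,D_j)$ (multiset unions). The family is an $(n,m,k,\lambda)$-DDF if $\mathrm{Int}(\mathcal{S}')=\lambda G^*$, and an $(n,m,k,\lambda)$-EDF if $\mathrm{Ext}(\mathcal{S}')=\lambda G^*$. If moreover all $D_i\subseteq G^*$, it is an $(n,m,k,\lambda,\mu)$-DPDF if $\mathrm{Int}(\mathcal{S}')=\lambda S+\mu(G^*\setminus S)$, and an $(n,m,k,\lambda,\mu)$-EPDF if $\mathrm{Ext}(\mathcal{S}')=\lambda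 S+\mu(G^*\setminus S)$; these are called proper if $\lambda\ne\mu$. All frequencies $\lambda,\mu$ are non-negative integers. **Theorem.** Let $q=ef+1$ be a prime power, let $\epsilon>1$ be a divisor of $e$, and let $\alpha$ be a primitive element of $\mathrm{GF}(q)$. For $d\in\{e,\epsilon\}$ write $C_i^d=\alpha^i\langle\alpha^d\rangle$, and for $0\le i\le\epsilon-1$ let $\phi_i$ be the number of $x\in C_0^e$ with $x\ne1$ and $x-1\in C_i^\epsilon$. Suppose that $C_0^\epsilon$ is a $(q,\frac{q-1}{\epsilon},\lambda)$-difference set in the additive group of $\mathrm{GF}(q)$, and consider the family ${C_0^\epsilon}'=\{C_0^e,C_\epsilon^e,\dots,C_{e-\epsilon}^e\}$, which partitions $C_0^\epsilon$. Then $\lambda=\frac{q-1-\epsilon}{\epsilon^2}$, and: (i) if $\phi_i\ne\phi_j$ for some distinct $i,j\in\{1,\dots,\epsilon-1\}$, then ${C_0^\epsilon}'$ is neither a DPDF nor an EPDF, for any parameters; (ii) otherwise, ${C_0^\epsilon}'$ is a $(q,\frac{e}{\epsilon},f,\frac{f-1}{\epsilon})$-DDF and a $(q,\frac{e}{\epsilon},f,\frac{(e-\epsilon)f}{\epsilon^2})$-EDF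 (in particular these parameters are integers). In particular, ${C_0^\epsilon}'$ is never a proper DPDF and never a proper EPDF. -/

import Mathlib

namespace DiffFam

section Group

variable {G : Type*} [AddGroup G] [DecidableEq G]

/-- The multiset `Δ(D) = {x - y : x ≠ y ∈ D}`. -/
def intDiff (D : Finset G) : Multiset G :=
  D.offDiag.val.map fun p => p.1 - p.2

/-- The multiset `Δ(D₁, D₂) = {x - y : x ∈ D₁, y ∈ D₂}`. -/
def extDiff (D₁ D₂ : Finset G) : Multiset G :=
  (D₁ ×ˢ D₂).val.map fun p => p.1 - p.2

/-- The multiset union of the internal differences of the members of a family. -/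
def intFam {m : ℕ} (D : Fin m → Finset G) : Multiset G :=
  ∑ i, intDiff (D i)

/-- The multiset union, over ordered pairs of distinct indices, of the external differences. -/
def extFam {m : ℕ} (D : Fin m → Finset G) : Multiset G :=
  ∑ p ∈ (Finset.univ : Finset (Fin m)).offDiag, extDiff (D p.1) (D p.2)

/-- The union of the members of a family. -/
def union {m : ℕ} (D : Fin m → Finset G) : Finset G :=
  Finset.univ.biUnion D

variable [Fintype G]

/-- The set `G* = G \ {0}`. -/
def star (G : Type*) [AddGroup G] [DecidableEq G] [Fintype G] : Finset G :=
  Finset.univ.erase 0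

/-- `D` is an `(n, k, lam)`-difference set in `G`. -/
structure IsDS (n k lam : ℕ) (D : Finset G) : Prop where
  order : Fintype.card G = n
  card : D.card = k
  diff : intDiff D = lam • (star G).val

/-- `D` is an `(n, m, k, lam)`-disjoint difference family in `G`. -/
structure IsDDF (n m k lam : ℕ) (D : Fin m → Finset G) : Prop where
  order : Fintype.card G = n
  card : ∀ i, (D i).card = k
  disj : ∀ i j, i ≠ j → Disjoint (D i) (D j)
  diff : intFam D = lam • (star G).val

/-- `D` is an `(n, m, k, lam)`-external difference family in `G`. -/
structure IsEDF (n m k lam : ℕ) (D : Fin m → Finset G) : Prop where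
  order : Fintype.card G = n
  card : ∀ i, (D i).card = k
  disj : ∀ i j, i ≠ j → Disjoint (D i) (D j)
  diff : extFam D = lam • (star G).val

/-- `D` is an `(n, m, k, lam, mu)`-disjoint partial difference family in `G`. -/
structure IsDPDF (n m k lam mu : ℕ) (D : Fin m → Finset G) : Prop where
  order : Fintype.card G = n
  subset : ∀ i, D i ⊆ star G
  card : ∀ i, (D i).card = k
  disj : ∀ i j, i ≠ j → Disjoint (D i) (D j)
  diff : intFam D = lam • (union D).val + mu • (star G \ union D).val

/-- `D` is an `(n, m, k, lam, mu)`-external partial difference family in `G`. -/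
structure IsEPDF (n m k lam mu : ℕ) (D : Fin m → Finset G) : Prop where
  order : Fintype.card G = n
  subset : ∀ i, D i ⊆ star G
  card : ∀ i, (D i).card = k
  disj : ∀ i j, i ≠ j → Disjoint (D i) (D j)
  diff : extFam D = lam • (union D).val + mu • (star G \ union D).val

/-- A proper disjoint partial difference family: the two frequencies differ. -/
def IsProperDPDF (n m k lam mu : ℕ) (D : Fin m → Finset G) : Prop :=
  IsDPDF n m k lam mu D ∧ lam ≠ mu

/-- A proper external partial difference family: the two frequencies differ. -/
def IsProperEPDF (n m k lam mu : ℕ) (D : Fin m → Finset G) : Prop :=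
  IsEPDF n m k lam mu D ∧ lam ≠ mu

end Group

section Cyclotomy

variable {F : Type*} [Field F] [Fintype F]

open Classical in
/-- The cyclotomic class `C_i^e = α^i ⟨α^e⟩`, as a set of elements of the field. -/
noncomputable def cycClass (α : Fˣ) (e i : ℕ) : Finset F :=
  Finset.univ.filter fun x => ∃ u ∈ Subgroup.zpowers (α ^ e), x = ((α ^ i * u : Fˣ) : F)

/-- The family `C_0^e, C_ε^e, …, C_{e-ε}^e` of classes of order `e` inside `C_0^ε`. -/
noncomputable def cycFamily (α : Fˣ) (e ε : ℕ) : Fin (e / ε) → Finset F :=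
  fun i => cycClass α e (i * ε)

open Classical in
/-- `φ_i`, the number of `x ∈ C_0^e` with `x ≠ 1` and `x - 1 ∈ C_i^ε`. -/
noncomputable def phi (α : Fˣ) (e ε i : ℕ) : ℕ :=
  ((cycClass α e 0).filter fun x => x ≠ 1 ∧ x - 1 ∈ cycClass α ε i).card

end Cyclotomy

end DiffFam

namespace DiffFam

/-! ### Difference multisets in a finite abelian group -/

section Group

variable {G : Type*} [AddCommGroup G]

/-! Write S for `C_0^ε`. Multiplication by S permutes the family, so the internal frequency is
constant, equal to φ_j, on each `C_j^ε` (`count_intFam_cycFamily`). Since S is a difference set,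
internal and external frequencies add up to λ off 0 (`intFam_add_extFam`), so the external claims
follow from the internal ones.

The crux is that an internal frequency equal to a on S and b off S must have a = b
(`eq_of_count_intFam_cycFamily`). Internal differences are invariant under negation, so a ≠ b forces
S = -S. Every nontrivial character sum over S is then a square root of |S| - λ, and summing over all
characters, with 0 ∉ S, shows that |S| - λ divides |S|² (`card_eq_of_symmetric`). Counting
differences gives |S| = 1 + λε, coprime to λ, so |S| = λ + 1. Hence λ = 0 and S = {1}, which has no
internal differences, so a = b after all. -/

lemma card_intDiff (D : Finset G) : (intDiff D).card = D.card * D.card - D.card := by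
  rw [intDiff, Multiset.card_map, Finset.card_val, Finset.offDiag_card]

/-- As a sum of singletons, the multiset can be split along a partition of the index pairs. -/
lemma intDiff_eq_sum (D : Finset G) : intDiff D = ∑ p ∈ D.offDiag, {p.1 - p.2} := by
  rw [← Multiset.sum_map_singleton (intDiff D), intDiff, Multiset.map_map]
  rfl

lemma extDiff_eq_sum (D₁ D₂ : Finset G) :
    extDiff D₁ D₂ = ∑ p ∈ D₁ ×ˢ D₂, {p.1 - p.2} := by
  rw [← Multiset.sum_map_singleton (extDiff D₁ D₂), extDiff, Multiset.map_map]
  rfl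

variable [DecidableEq G]

lemma count_intDiff (D : Finset G) (g : G) :
    (intDiff D).count g = (D.offDiag.filter fun p => g = p.1 - p.2).card := by
  rw [intDiff, Multiset.count_map]
  rfl

lemma count_intFam {m : ℕ} (D : Fin m → Finset G) (g : G) :
    (intFam D).count g = ∑ i, (intDiff (D i)).count g :=
  Multiset.count_sum'

/-- Internal and external differences of a disjoint family make up the differences of its
union. -/
lemma intFam_add_extFam {m : ℕ} (D : Fin m → Finset G)
    (hD : ∀ i j, i ≠ j → Disjoint (D i) (D j)) :
    intFam D + extFam D = intDiff (union D) := by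
  have hu : (union D).offDiag = (Finset.univ.biUnion fun i => (D i).offDiag) ∪
      (Finset.univ : Finset (Fin m)).offDiag.biUnion fun p => D p.1 ×ˢ D p.2 := by
    ext ⟨x, y⟩
    simp only [union, Finset.mem_offDiag, Finset.mem_biUnion, Finset.mem_univ, true_and,
      Finset.mem_union, Finset.mem_product, Prod.exists]
    constructor
    · rintro ⟨⟨i, hi⟩, ⟨j, hj⟩, hxy⟩
      by_cases hij : i = j
      · subst hij
        exact Or.inl ⟨i, hi, hj, hxy⟩
      · exact Or.inr ⟨i, j, hij, hi, hj⟩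
    · rintro (⟨i, hi, hj, hxy⟩ | ⟨i, j, hij, hi, hj⟩)
      · exact ⟨⟨i, hi⟩, ⟨i, hj⟩, hxy⟩
      · refine ⟨⟨i, hi⟩, ⟨j, hj⟩, ?_⟩
        rintro rfl
        exact Finset.disjoint_left.1 (hD i j hij) hi hj
  have huniq : ∀ {i j x}, x ∈ D i → x ∈ D j → i = j := by
    intro i j x hi hj
    by_contra h
    exact Finset.disjoint_left.1 (hD i j h) hi hj
  rw [intDiff_eq_sum, hu, Finset.sum_union, Finset.sum_biUnion, Finset.sum_biUnion]
  · simp only [intFam, extFam, intDiff_eq_sum, extDiff_eq_sum]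
  · rintro ⟨i, j⟩ - ⟨i', j'⟩ - hne
    refine Finset.disjoint_left.2 ?_
    rintro ⟨x, y⟩ h h'
    simp only [Finset.mem_product] at h h'
    exact hne (Prod.ext (huniq h.1 h'.1) (huniq h.2 h'.2))
  · rintro i - j - hne
    refine Finset.disjoint_left.2 ?_
    rintro ⟨x, y⟩ h h'
    simp only [Finset.mem_offDiag] at h h'
    exact hne (huniq h.1 h'.1)
  · refine Finset.disjoint_left.2 ?_
    rintro ⟨x, y⟩ h h'
    simp only [Finset.mem_biUnion, Finset.mem_offDiag, Finset.mem_univ, true_and,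
      Finset.mem_product, Prod.exists] at h h'
    obtain ⟨i, hx, hy, -⟩ := h
    obtain ⟨j, l, hjl, hx', hy'⟩ := h'
    exact hjl ((huniq hx' hx).trans (huniq hy hy'))

/-- Swapping the two entries of a pair negates its difference. This is what later forces the
difference set to be symmetric. -/
lemma count_neg_intDiff (D : Finset G) (g : G) :
    (intDiff D).count (-g) = (intDiff D).count g := by
  rw [count_intDiff, count_intDiff]
  refine Finset.card_nbij' Prod.swap Prod.swap ?_ ?_ (fun _ _ => rfl) (fun _ _ => rfl)
  · rintro ⟨x, y⟩ h
    simp only [Finset.coe_filter, Finset.mem_offDiag, Set.mem_ofPred_eq, Prod.swap] at h ⊢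
    exact ⟨⟨h.1.2.1, h.1.1, h.1.2.2.symm⟩, by rw [← neg_neg g, h.2, neg_sub]⟩
  · rintro ⟨x, y⟩ h
    simp only [Finset.coe_filter, Finset.mem_offDiag, Set.mem_ofPred_eq, Prod.swap] at h ⊢
    exact ⟨⟨h.1.2.1, h.1.1, h.1.2.2.symm⟩, by rw [h.2, neg_sub]⟩

lemma count_neg_intFam {m : ℕ} (D : Fin m → Finset G) (g : G) :
    (intFam D).count (-g) = (intFam D).count g := by
  simp only [count_intFam, count_neg_intDiff]

lemma count_zero_intFam {m : ℕ} (D : Fin m → Finset G) : (intFam D).count 0 = 0 := by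
  rw [count_intFam]
  refine Finset.sum_eq_zero fun i _ => ?_
  rw [count_intDiff, Finset.card_eq_zero, Finset.filter_eq_empty_iff]
  rintro ⟨x, y⟩ h h'
  rw [Finset.mem_offDiag] at h
  exact h.2.2 (sub_eq_zero.1 h'.symm)

variable [Fintype G]

lemma mem_star {x : G} : x ∈ star G ↔ x ≠ 0 := by simp [star]

lemma card_star : (star G).card = Fintype.card G - 1 := by
  simp [star]

lemma count_nsmul_star (a : ℕ) (g : G) :
    (a • (star G).val).count g = if g = 0 then 0 else a := by
  rw [Multiset.count_nsmul, Multiset.count_eq_of_nodup (star G).nodup]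
  by_cases h : g = 0 <;> simp [mem_star, h]

lemma count_partial (S : Finset G) (a b : ℕ) {g : G} (hg : g ≠ 0) :
    (a • S.val + b • (star G \ S).val).count g = if g ∈ S then a else b := by
  rw [Multiset.count_add, Multiset.count_nsmul, Multiset.count_nsmul,
    Multiset.count_eq_of_nodup S.nodup, Multiset.count_eq_of_nodup (star G \ S).nodup]
  simp only [Finset.mem_val, Finset.mem_sdiff, mem_star]
  by_cases h : g ∈ S <;> simp [h, hg]

/-! ### Character sums of symmetric difference sets -/

/-- The squared character value of a symmetric difference set. -/
lemma sq_charSum_of_symmetric {D : Finset G} {lam : ℕ}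
    (hdiff : intDiff D = lam • (star G).val) (hsymm : ∀ x ∈ D, -x ∈ D)
    (χ : AddChar G ℂ) (hχ : χ ≠ 0) :
    (∑ x ∈ D, χ x) ^ 2 = (D.card : ℂ) - lam := by
  have hneg : ∑ x ∈ D, χ x = ∑ x ∈ D, χ (-x) :=
    Finset.sum_nbij' Neg.neg Neg.neg hsymm hsymm (by simp) (by simp) (by simp)
  have hoff : ∑ p ∈ D.offDiag, χ (p.1 - p.2) = -(lam : ℂ) := by
    have h1 : ∑ p ∈ D.offDiag, χ (p.1 - p.2) = ((intDiff D).map χ).sum := by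
      rw [intDiff, Multiset.map_map]
      rfl
    have h2 : ∑ x ∈ star G, χ x = -1 := by
      have h := Finset.add_sum_erase Finset.univ (fun x => χ x) (Finset.mem_univ (0 : G))
      rw [AddChar.sum_eq_zero_iff_ne_zero.2 hχ, AddChar.map_zero_eq_one] at h
      rw [star]
      linear_combination h
    rw [h1, hdiff, Multiset.map_nsmul, Multiset.sum_nsmul]
    change lam • ∑ x ∈ star G, χ x = _
    rw [h2]
    simp
  calc (∑ x ∈ D, χ x) ^ 2 = (∑ x ∈ D, χ x) * ∑ x ∈ D, χ (-x) := by rw [← hneg, sq]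
    _ = ∑ p ∈ D ×ˢ D, χ (p.1 - p.2) := by
      rw [Finset.sum_mul_sum, Finset.sum_product]
      simp only [sub_eq_add_neg, AddChar.map_add_eq_mul]
    _ = (D.card : ℂ) - lam := by
      rw [← Finset.diag_union_offDiag, Finset.sum_union (Finset.disjoint_diag_offDiag _), hoff,
        Finset.sum_diag]
      simp [sub_eq_add_neg]

/-- A symmetric difference set that avoids zero and whose size and frequency are coprime has
order one. -/
lemma card_eq_of_symmetric {D : Finset G} {lam : ℕ}
    (hdiff : intDiff D = lam • (star G).val) (hsymm : ∀ x ∈ D, -x ∈ D)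
    (h0 : (0 : G) ∉ D) (hpos : D.Nonempty) (hcop : Nat.Coprime D.card lam) :
    D.card = lam + 1 := by
  classical
  -- The root is taken in ℂ because the sign of |D| - λ is not yet known.
  obtain ⟨r, hr⟩ := IsAlgClosed.exists_pow_nat_eq ((D.card : ℂ) - lam) (n := 2) two_pos
  have hsign : ∀ χ : AddChar G ℂ, ∃ s : ℤ, χ ≠ 0 → ∑ x ∈ D, χ x = s * r := by
    intro χ
    by_cases hχ : χ = 0
    · exact ⟨0, fun h => (h hχ).elim⟩
    · rcases sq_eq_sq_iff_eq_or_eq_neg.1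
        ((sq_charSum_of_symmetric hdiff hsymm χ hχ).trans hr.symm) with h | h
      · exact ⟨1, fun _ => by simp [h]⟩
      · exact ⟨-1, fun _ => by simp [h]⟩
  choose s hs using hsign
  -- Orthogonality: the characters sum to 0 at every x ≠ 0. The trivial character contributes |D|,
  -- the others an integer multiple of r.
  have htotal : ∑ χ : AddChar G ℂ, ∑ x ∈ D, χ x = 0 := by
    rw [Finset.sum_comm]
    refine Finset.sum_eq_zero fun x hx => AddChar.sum_apply_eq_zero_iff_ne_zero.2 ?_
    rintro rfl
    exact h0 hx
  have hsplit : (D.card : ℂ) + ((∑ χ ∈ Finset.univ.erase (0 : AddChar G ℂ), s χ : ℤ) : ℂ) * r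
      = 0 := by
    rw [← htotal, ← Finset.add_sum_erase _ _ (Finset.mem_univ (0 : AddChar G ℂ))]
    congr 1
    · simp
    · push_cast
      rw [Finset.sum_mul]
      exact Finset.sum_congr rfl fun χ hχ => (hs χ (Finset.ne_of_mem_erase hχ)).symm
  generalize ∑ χ ∈ Finset.univ.erase (0 : AddChar G ℂ), s χ = t at hsplit
  have hsq : (D.card : ℤ) ^ 2 = ((D.card : ℤ) - lam) * t ^ 2 := by
    have : (D.card : ℂ) ^ 2 = ((D.card : ℂ) - lam) * t ^ 2 := by
      rw [← hr]
      linear_combination ((D.card : ℂ) - t * r) * hsplit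
    exact_mod_cast this
  have hk : (0 : ℤ) < D.card := by exact_mod_cast hpos.card_pos
  -- Positivity rules out the unit -1 at the end.
  have hN : (0 : ℤ) < (D.card : ℤ) - lam := by
    by_contra hle
    nlinarith [sq_nonneg t, mul_pos hk hk]
  have hcop' : IsCoprime ((D.card : ℤ) - lam) ((D.card : ℤ) ^ 2) := by
    refine IsCoprime.pow_right ?_
    have h : IsCoprime (lam : ℤ) D.card := (Nat.isCoprime_iff_coprime.2 hcop).symm
    obtain ⟨u, v, huv⟩ := h
    exact ⟨-u, u + v, by linear_combination huv⟩
  have hunit := hcop'.isUnit_of_dvd' dvd_rfl ⟨_, hsq⟩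
  rcases Int.isUnit_iff.1 hunit with h | h <;> omega

end Group

/-! ### Cyclotomic classes as congruence classes of exponents -/

section Cyclotomy

variable {F : Type*} [Field F]

lemma exists_zpow_eq {α : Fˣ} (hα : ∀ x : Fˣ, x ∈ Subgroup.zpowers α) {x : F} (hx : x ≠ 0) :
    ∃ a : ℤ, x = ((α ^ a : Fˣ) : F) := by
  obtain ⟨a, ha⟩ := hα (Units.mk0 x hx)
  exact ⟨a, by simpa using congrArg Units.val ha.symm⟩

variable [Fintype F]

lemma mem_cycClass {α : Fˣ} {d i : ℕ} {x : F} :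
    x ∈ cycClass α d i ↔ ∃ u ∈ Subgroup.zpowers (α ^ d), x = ((α ^ i * u : Fˣ) : F) := by
  simp [cycClass]

lemma ne_zero_of_mem_cycClass {α : Fˣ} {d i : ℕ} {x : F} (hx : x ∈ cycClass α d i) : x ≠ 0 := by
  obtain ⟨u, -, rfl⟩ := mem_cycClass.1 hx
  exact Units.ne_zero _

lemma one_mem_cycClass (α : Fˣ) (d : ℕ) : (1 : F) ∈ cycClass α d 0 :=
  mem_cycClass.2 ⟨1, one_mem _, by simp⟩

lemma mul_mem_cycClass {α : Fˣ} {d i : ℕ} {x y : F} (hx : x ∈ cycClass α d i)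
    (hy : y ∈ cycClass α d 0) : x * y ∈ cycClass α d i := by
  obtain ⟨u, hu, rfl⟩ := mem_cycClass.1 hx
  obtain ⟨v, hv, rfl⟩ := mem_cycClass.1 hy
  exact mem_cycClass.2 ⟨u * v, mul_mem hu hv, by push_cast; ring⟩

lemma div_mem_cycClass_zero {α : Fˣ} {d i : ℕ} {x y : F} (hx : x ∈ cycClass α d i)
    (hy : y ∈ cycClass α d i) : x / y ∈ cycClass α d 0 := by
  obtain ⟨u, hu, rfl⟩ := mem_cycClass.1 hx
  obtain ⟨v, hv, rfl⟩ := mem_cycClass.1 hy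
  refine mem_cycClass.2 ⟨u / v, div_mem hu hv, ?_⟩
  rw [← Units.val_div_eq_div_val, mul_div_mul_left_eq_div, pow_zero, one_mul]

lemma div_mem_cycClass {α : Fˣ} {d i : ℕ} {x y : F} (hx : x ∈ cycClass α d i)
    (hy : y ∈ cycClass α d 0) : x / y ∈ cycClass α d i := by
  have h := mul_mem_cycClass hx (div_mem_cycClass_zero (one_mem_cycClass α d) hy)
  rwa [mul_one_div] at h

/-- Exponents of α are determined modulo its order, hence modulo d. -/
lemma zpow_mem_cycClass {α : Fˣ} {d i : ℕ} (hd : d ∣ orderOf α) (a : ℤ) :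
    ((α ^ a : Fˣ) : F) ∈ cycClass α d i ↔ (d : ℤ) ∣ a - i := by
  rw [mem_cycClass]
  constructor
  · rintro ⟨_, ⟨n, rfl⟩, h⟩
    have h' : α ^ a = α ^ ((i : ℤ) + d * n) := by
      rw [Units.val_inj.1 h, zpow_add, zpow_mul, zpow_natCast, zpow_natCast]
    have hdvd := (Int.natCast_dvd_natCast.2 hd).trans (zpow_eq_zpow_iff_modEq.1 h').dvd
    rw [show a - i = d * n - ((i : ℤ) + d * n - a) by ring]
    exact dvd_sub (Dvd.intro n rfl) hdvd
  · rintro ⟨c, hc⟩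
    refine ⟨_, ⟨c, rfl⟩, ?_⟩
    rw [show a = (i : ℤ) + d * c by omega, zpow_add, zpow_mul, zpow_natCast, zpow_natCast]

lemma pow_mem_cycClass_self (α : Fˣ) (d i : ℕ) : ((α ^ i : Fˣ) : F) ∈ cycClass α d i :=
  mem_cycClass.2 ⟨1, one_mem _, by simp⟩

lemma card_cycClass {α : Fˣ} {d : ℕ} (i : ℕ) (hd0 : d ≠ 0) (hd : d ∣ orderOf α) :
    (cycClass α d i).card = orderOf α / d := by
  classical
  have himage : cycClass α d i = (Finset.univ : Finset (Subgroup.zpowers (α ^ d))).image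
      fun u : Subgroup.zpowers (α ^ d) => ((α ^ i * (u : Fˣ) : Fˣ) : F) := by
    ext x
    simp only [mem_cycClass, Finset.mem_image, Finset.mem_univ, true_and, Subtype.exists,
      exists_prop, eq_comm]
  rw [himage, Finset.card_image_of_injective, Finset.card_univ, Fintype.card_zpowers,
    orderOf_pow_of_dvd hd0 hd]
  intro u v huv
  exact Subtype.ext (mul_left_cancel (Units.val_inj.1 huv))

lemma exists_mem_cycClass {α : Fˣ} (hα : ∀ x : Fˣ, x ∈ Subgroup.zpowers α) {d : ℕ} (hd0 : d ≠ 0)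
    (hd : d ∣ orderOf α) {x : F} (hx : x ≠ 0) : ∃ j < d, x ∈ cycClass α d j := by
  obtain ⟨a, rfl⟩ := exists_zpow_eq hα hx
  have hpos : (0 : ℤ) < d := by exact_mod_cast Nat.pos_of_ne_zero hd0
  have h1 := Int.emod_nonneg a hpos.ne'
  have h2 := Int.emod_lt_of_pos a hpos
  refine ⟨(a % d).toNat, by omega, (zpow_mem_cycClass hd a).2 ?_⟩
  rw [Int.toNat_of_nonneg h1]
  exact Int.dvd_self_sub_emod

lemma pow_notMem_cycClass_zero {α : Fˣ} {d j : ℕ} (hd : d ∣ orderOf α) (h0 : 0 < j) (hj : j < d) :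
    ((α ^ j : Fˣ) : F) ∉ cycClass α d 0 := by
  intro h
  rw [← zpow_natCast, zpow_mem_cycClass hd] at h
  have : d ∣ j := by exact_mod_cast (by simpa using h : (d : ℤ) ∣ j)
  exact absurd (Nat.le_of_dvd h0 this) (by omega)

lemma eq_of_mem_cycFamily {α : Fˣ} (hα : ∀ x : Fˣ, x ∈ Subgroup.zpowers α) {e ε : ℕ}
    (he : e ∣ orderOf α) (hε0 : ε ≠ 0) (hε : ε ∣ e) {i j : Fin (e / ε)} {x : F}
    (hi : x ∈ cycFamily α e ε i)
    (hj : x ∈ cycFamily α e ε j) : i = j := by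
  obtain ⟨a, rfl⟩ := exists_zpow_eq hα (ne_zero_of_mem_cycClass hi)
  have hi' := (zpow_mem_cycClass he a).1 hi
  have hj' := (zpow_mem_cycClass he a).1 hj
  obtain ⟨m, hm⟩ := hε
  have hem : e / ε = m := by rw [hm, Nat.mul_div_cancel_left _ (Nat.pos_of_ne_zero hε0)]
  have hdvd : ((ε : ℤ) * m) ∣ ε * ((i : ℕ) - (j : ℕ)) := by
    have hcast : (ε : ℤ) * m = e := by exact_mod_cast hm.symm
    rw [hcast, show (ε : ℤ) * ((i : ℕ) - (j : ℕ)) =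
      (a - ((j : ℕ) * ε : ℕ)) - (a - ((i : ℕ) * ε : ℕ)) by push_cast; ring]
    exact dvd_sub hj' hi'
  have hdvd' : (m : ℤ) ∣ (i : ℕ) - (j : ℕ) :=
    (mul_dvd_mul_iff_left (by exact_mod_cast hε0)).1 hdvd
  have hil := i.2
  have hjl := j.2
  have := Int.eq_zero_of_abs_lt_dvd hdvd' (by rw [abs_lt]; omega)
  exact Fin.ext (by omega)

lemma disjoint_cycFamily {α : Fˣ} (hα : ∀ x : Fˣ, x ∈ Subgroup.zpowers α) {e ε : ℕ}
    (he : e ∣ orderOf α) (hε0 : ε ≠ 0) (hε : ε ∣ e) (i j : Fin (e / ε)) (hij : i ≠ j) :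
    Disjoint (cycFamily α e ε i) (cycFamily α e ε j) :=
  Finset.disjoint_left.2 fun _ hi hj => hij (eq_of_mem_cycFamily hα he hε0 hε hi hj)

lemma mem_cycClass_iff_exists_cycFamily {α : Fˣ} (hα : ∀ x : Fˣ, x ∈ Subgroup.zpowers α)
    {e ε : ℕ} (he0 : e ≠ 0) (he : e ∣ orderOf α) (hε : ε ∣ e) {x : F} :
    x ∈ cycClass α ε 0 ↔ ∃ i, x ∈ cycFamily α e ε i := by
  have hε0 : 0 < ε := Nat.pos_of_dvd_of_pos hε (Nat.pos_of_ne_zero he0)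
  have hmpos : 0 < e / ε := Nat.div_pos (Nat.le_of_dvd (Nat.pos_of_ne_zero he0) hε) hε0
  have hem : (e : ℤ) = ε * (e / ε : ℕ) := by exact_mod_cast (Nat.mul_div_cancel' hε).symm
  constructor
  · intro hx
    obtain ⟨a, rfl⟩ := exists_zpow_eq hα (ne_zero_of_mem_cycClass hx)
    obtain ⟨c, hc⟩ := (zpow_mem_cycClass (hε.trans he) a).1 hx
    have hmz : (0 : ℤ) < (e / ε : ℕ) := by exact_mod_cast hmpos
    have h1 := Int.emod_nonneg c hmz.ne'
    have h2 := Int.emod_lt_of_pos c hmz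
    refine ⟨⟨(c % (e / ε : ℕ)).toNat, by omega⟩, (zpow_mem_cycClass he a).2 ?_⟩
    rw [Nat.cast_mul, Int.toNat_of_nonneg h1, show a = ε * c by simpa using hc, mul_comm _ (ε : ℤ),
      ← mul_sub]
    nth_rw 1 [hem]
    exact mul_dvd_mul_left _ Int.dvd_self_sub_emod
  · rintro ⟨i, hi⟩
    obtain ⟨a, rfl⟩ := exists_zpow_eq hα (ne_zero_of_mem_cycClass hi)
    have h := (zpow_mem_cycClass he a).1 hi
    refine (zpow_mem_cycClass (hε.trans he) a).2 ?_
    rw [show a - (0 : ℕ) = (a - ((i : ℕ) * ε : ℕ)) + (i : ℕ) * ε by push_cast; ring]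
    exact dvd_add ((Int.natCast_dvd_natCast.2 hε).trans h) (Dvd.intro_left _ rfl)

/-! ### Internal frequencies of the cyclotomic family -/

variable [DecidableEq F]

lemma union_cycFamily {α : Fˣ} (hα : ∀ x : Fˣ, x ∈ Subgroup.zpowers α)
    {e ε : ℕ} (he0 : e ≠ 0) (he : e ∣ orderOf α) (hε : ε ∣ e) :
    union (cycFamily α e ε) = cycClass α ε 0 := by
  ext x
  simp [union, mem_cycClass_iff_exists_cycFamily hα he0 he hε]

lemma phi_eq_card (α : Fˣ) (e ε j : ℕ) : phi α e ε j =
    ((cycClass α e 0).filter fun x => x ≠ 1 ∧ x - 1 ∈ cycClass α ε j).card := by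
  rw [phi]
  congr!

/-- The internal frequency of the family at an element of `C_j^ε` is `φ_j`. -/
lemma count_intFam_cycFamily {α : Fˣ} (hα : ∀ x : Fˣ, x ∈ Subgroup.zpowers α)
    {e ε : ℕ} (he0 : e ≠ 0) (he : e ∣ orderOf α) (hε : ε ∣ e) {j : ℕ} {g : F}
    (hg : g ∈ cycClass α ε j) : (intFam (cycFamily α e ε)).count g = phi α e ε j := by
  have hε0 : ε ≠ 0 := (Nat.pos_of_dvd_of_pos hε (Nat.pos_of_ne_zero he0)).ne'
  have hsub : ∀ {i y}, y ∈ cycFamily α e ε i → y ∈ cycClass α ε 0 := fun {i _} h =>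
    (mem_cycClass_iff_exists_cycFamily hα he0 he hε).2 ⟨i, h⟩
  simp only [count_intFam, count_intDiff]
  rw [← Finset.card_sigma, phi_eq_card]
  -- With t = x / y, the equation g = x - y becomes y = g / (t - 1), so t determines the pair and
  -- hence the class containing it.
  refine Finset.card_bij (fun p _ => p.2.1 / p.2.2) ?_ ?_ ?_
  · rintro ⟨i, x, y⟩ h
    simp only [Finset.mem_sigma, Finset.mem_univ, true_and, Finset.mem_filter,
      Finset.mem_offDiag] at h
    obtain ⟨⟨hx, hy, hxy⟩, hgxy⟩ := h
    have hy0 := ne_zero_of_mem_cycClass hy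
    refine Finset.mem_filter.2
      ⟨div_mem_cycClass_zero hx hy, fun h => hxy ((div_eq_one_iff_eq hy0).1 h), ?_⟩
    rw [show x / y - 1 = g / y by rw [hgxy, sub_div, div_self hy0]]
    exact div_mem_cycClass hg (hsub hy)
  · rintro ⟨i, x, y⟩ h ⟨i', x', y'⟩ h' heq
    simp only [Finset.mem_sigma, Finset.mem_univ, true_and, Finset.mem_filter,
      Finset.mem_offDiag] at h h' heq
    obtain ⟨⟨hx, hy, hxy⟩, hgxy⟩ := h
    obtain ⟨⟨hx', hy', hxy'⟩, hgxy'⟩ := h'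
    have hy0 := ne_zero_of_mem_cycClass hy
    have hy0' := ne_zero_of_mem_cycClass hy'
    have hcross : x * y' = x' * y := (div_eq_div_iff hy0 hy0').1 heq
    have hyy : y = y' := by
      have : g * (y - y') = 0 := by linear_combination (y) * hgxy' - y' * hgxy - hcross
      exact sub_eq_zero.1 ((mul_eq_zero.1 this).resolve_left (ne_zero_of_mem_cycClass hg))
    subst hyy
    have hxx : x = x' := mul_right_cancel₀ hy0 hcross
    subst hxx
    obtain rfl := eq_of_mem_cycFamily hα he hε0 hε hx hx'
    rfl
  · intro t ht
    obtain ⟨ht, ht1, htj⟩ := Finset.mem_filter.1 ht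
    have hsub0 : t - 1 ≠ 0 := sub_ne_zero.2 ht1
    obtain ⟨i, hi⟩ := (mem_cycClass_iff_exists_cycFamily hα he0 he hε).1
      (div_mem_cycClass_zero hg htj)
    have hy0 := ne_zero_of_mem_cycClass hi
    refine ⟨⟨i, g / (t - 1) * t, g / (t - 1)⟩, ?_, mul_div_cancel_left₀ _ hy0⟩
    simp only [Finset.mem_sigma, Finset.mem_univ, true_and, Finset.mem_filter,
      Finset.mem_offDiag]
    refine ⟨⟨mul_mem_cycClass hi ht, hi, fun h => ht1 ?_⟩, by field_simp⟩
    exact mul_left_cancel₀ hy0 (h.trans (mul_one _).symm)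

/-- If the internal frequencies of the family take one value on the difference set `C_0^ε` and
one value on its complement, then the two values agree. -/
lemma eq_of_count_intFam_cycFamily {α : Fˣ} (hα : ∀ x : Fˣ, x ∈ Subgroup.zpowers α)
    {e ε lam : ℕ} (he0 : e ≠ 0) (he : e ∣ orderOf α) (hε1 : 1 < ε) (hε : ε ∣ e)
    (hdiff : intDiff (cycClass α ε 0) = lam • (star F).val)
    (hcard : (cycClass α ε 0).card = 1 + lam * ε) {a b : ℕ}
    (hab : ∀ g ≠ 0, (intFam (cycFamily α e ε)).count g = if g ∈ cycClass α ε 0 then a else b) :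
    a = b := by
  by_contra hne
  have hsymm : ∀ x ∈ cycClass α ε 0, -x ∈ cycClass α ε 0 := by
    intro x hx
    have hx0 := ne_zero_of_mem_cycClass hx
    by_contra hnx
    have h := count_neg_intFam (cycFamily α e ε) x
    rw [hab _ (neg_ne_zero.2 hx0), hab _ hx0, if_pos hx, if_neg hnx] at h
    exact hne h.symm
  have hone := one_mem_cycClass α ε
  have hlam := card_eq_of_symmetric hdiff hsymm (fun h => ne_zero_of_mem_cycClass h rfl)
    ⟨1, hone⟩ (by rw [hcard]; simp)
  -- Compare 1 + λε with λ + 1, where ε > 1.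
  have hlam0 : lam = 0 := by nlinarith
  rw [hlam0] at hlam
  have hzero : ∀ g, (intFam (cycFamily α e ε)).count g = 0 := by
    intro g
    rw [count_intFam]
    refine Finset.sum_eq_zero fun i _ => ?_
    rw [count_intDiff, Finset.card_eq_zero, Finset.filter_eq_empty_iff]
    rintro ⟨x, y⟩ h
    obtain ⟨hx, hy, hxy⟩ := Finset.mem_offDiag.1 h
    exact absurd (Finset.card_le_one.1 hlam.le x
      ((mem_cycClass_iff_exists_cycFamily hα he0 he hε).2 ⟨i, hx⟩) y
      ((mem_cycClass_iff_exists_cycFamily hα he0 he hε).2 ⟨i, hy⟩)) hxy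
  have h1 := hab 1 one_ne_zero
  have h2 := hab ((α ^ 1 : Fˣ) : F) (Units.ne_zero _)
  rw [hzero, if_pos hone] at h1
  rw [hzero, if_neg (pow_notMem_cycClass_zero (hε.trans he) one_pos hε1)] at h2
  exact hne (h1.symm.trans h2)

end Cyclotomy

end DiffFam

/-! ### The main theorem -/

open DiffFam in
theorem mainTheorem3 {F : Type*} [Field F] [Fintype F] [DecidableEq F]
    (q e f ε lam : ℕ) (hF : Fintype.card F = q) (hq : q = e * f + 1)
    (hε : 1 < ε) (hεe : ε ∣ e)
    (α : Fˣ) (hα : ∀ x : Fˣ, x ∈ Subgroup.zpowers α)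
    (hDS : DiffFam.IsDS q ((q - 1) / ε) lam (DiffFam.cycClass α ε 0)) :
    (lam : ℚ) = ((q : ℚ) - 1 - ε) / (ε : ℚ) ^ 2 ∧
    ((∃ i ∈ Finset.Icc 1 (ε - 1), ∃ j ∈ Finset.Icc 1 (ε - 1),
        i ≠ j ∧ DiffFam.phi α e ε i ≠ DiffFam.phi α e ε j) →
      (∀ n k a b, ¬ DiffFam.IsDPDF n (e / ε) k a b (DiffFam.cycFamily α e ε)) ∧
      (∀ n k a b, ¬ DiffFam.IsEPDF n (e / ε) k a b (DiffFam.cycFamily α e ε))) ∧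
    ((¬ ∃ i ∈ Finset.Icc 1 (ε - 1), ∃ j ∈ Finset.Icc 1 (ε - 1),
        i ≠ j ∧ DiffFam.phi α e ε i ≠ DiffFam.phi α e ε j) →
      (ε ∣ f - 1 ∧
        DiffFam.IsDDF q (e / ε) f ((f - 1) / ε) (DiffFam.cycFamily α e ε)) ∧
      (ε ^ 2 ∣ (e - ε) * f ∧
        DiffFam.IsEDF q (e / ε) f ((e - ε) * f / ε ^ 2) (DiffFam.cycFamily α e ε))) ∧
    (∀ n k a b, ¬ DiffFam.IsProperDPDF n (e / ε) k a b (DiffFam.cycFamily α e ε)) ∧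
    (∀ n k a b, ¬ DiffFam.IsProperEPDF n (e / ε) k a b (DiffFam.cycFamily α e ε)) := by
  have hord : orderOf α = e * f := by
    rw [orderOf_eq_card_of_forall_mem_zpowers hα, Nat.card_eq_fintype_card, Fintype.card_units,
      hF, hq, Nat.add_sub_cancel]
  have hef : 0 < e * f := hord ▸ orderOf_pos α
  have he0 : e ≠ 0 := by rintro rfl; simp at hef
  have hf0 : 0 < f := Nat.pos_of_ne_zero (by rintro rfl; simp at hef)
  have hε0 : ε ≠ 0 := by omega
  have he : e ∣ orderOf α := hord ▸ Dvd.intro f rfl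
  have hεα := hεe.trans he
  obtain ⟨m, hm⟩ := id hεe
  have hm0 : 0 < m := Nat.pos_of_ne_zero (by rintro rfl; simp at hm; exact he0 hm)
  have hem : e / ε = m := by rw [hm, Nat.mul_div_cancel_left _ (by omega)]
  have hk : (cycClass α ε 0).card = m * f := by
    rw [card_cycClass 0 hε0 hεα, hord, hm, mul_assoc, Nat.mul_div_cancel_left _ (by omega)]
  -- Count differences: k(k - 1) = λ(q - 1) = λεk with k = mf.
  have hk1 : m * f = 1 + lam * ε := by
    have h := congrArg Multiset.card hDS.diff
    rw [card_intDiff, Multiset.card_nsmul, Finset.card_val, card_star, hF, hq,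
      Nat.add_sub_cancel, hk, hm] at h
    obtain ⟨k, hk⟩ : ∃ k, m * f = k + 1 := Nat.exists_eq_add_one.2 (Nat.mul_pos hm0 hf0)
    rw [mul_assoc ε, hk, ← Nat.sub_one_mul, Nat.add_sub_cancel, ← mul_assoc] at h
    have := Nat.eq_of_mul_eq_mul_right (Nat.succ_pos k) h
    rw [hk, this, add_comm]
  have hdisj := disjoint_cycFamily hα he hε0 hεe
  have hunion := union_cycFamily hα he0 he hεe
  have hsum : ∀ g ≠ 0, (intFam (cycFamily α e ε)).count g + (extFam (cycFamily α e ε)).count g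
      = lam := by
    intro g hg
    rw [← Multiset.count_add, intFam_add_extFam _ hdisj, hunion, hDS.diff, count_nsmul_star,
      if_neg hg]
  have hagree {a b : ℕ} (hab : ∀ g ≠ 0, (intFam (cycFamily α e ε)).count g =
      if g ∈ cycClass α ε 0 then a else b) : a = b :=
    eq_of_count_intFam_cycFamily hα he0 he hε hεe hDS.diff (hk.trans hk1) hab
  have hcount {g : F} {j : ℕ} (hg : g ∈ cycClass α ε j) :=
    count_intFam_cycFamily hα he0 he hεe hg
  have hdpdf {n k a b : ℕ} (h : IsDPDF n (e / ε) k a b (cycFamily α e ε)) :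
      ∀ g ≠ 0, (intFam (cycFamily α e ε)).count g = if g ∈ cycClass α ε 0 then a else b := by
    intro g hg
    rw [h.diff, hunion, count_partial _ _ _ hg]
  have hepdf {n k a b : ℕ} (h : IsEPDF n (e / ε) k a b (cycFamily α e ε)) :
      ∀ g ≠ 0, (extFam (cycFamily α e ε)).count g = if g ∈ cycClass α ε 0 then a else b := by
    intro g hg
    rw [h.diff, hunion, count_partial _ _ _ hg]
  have hpow {j : ℕ} (hj : j ∈ Finset.Icc 1 (ε - 1)) :
      ((α ^ j : Fˣ) : F) ∉ cycClass α ε 0 := by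
    rw [Finset.mem_Icc] at hj
    exact pow_notMem_cycClass_zero hεα (by omega) (by omega)
  refine ⟨?_, ?_, ?_, ?_, ?_⟩
  · have hεq : (ε : ℚ) ≠ 0 := by exact_mod_cast hε0
    have hk1q : (m : ℚ) * f = 1 + lam * ε := by exact_mod_cast hk1
    rw [hq, hm, eq_div_iff (pow_ne_zero 2 hεq)]
    push_cast
    linear_combination -(ε : ℚ) * hk1q
  · rintro ⟨i, hi, j, hj, -, hij⟩
    refine ⟨fun n k a b h => hij ?_, fun n k a b h => hij ?_⟩
    · have h1 := hdpdf h _ (Units.ne_zero (α ^ i))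
      have h2 := hdpdf h _ (Units.ne_zero (α ^ j))
      rw [if_neg (hpow hi), hcount (pow_mem_cycClass_self α ε i)] at h1
      rw [if_neg (hpow hj), hcount (pow_mem_cycClass_self α ε j)] at h2
      exact h1.trans h2.symm
    · have h1 := hsum _ (Units.ne_zero (α ^ i))
      have h2 := hsum _ (Units.ne_zero (α ^ j))
      rw [hepdf h _ (Units.ne_zero _), if_neg (hpow hi),
        hcount (pow_mem_cycClass_self α ε i)] at h1
      rw [hepdf h _ (Units.ne_zero _), if_neg (hpow hj),
        hcount (pow_mem_cycClass_self α ε j)] at h2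
      omega
  · intro hphi
    push Not at hphi
    -- φ_1 stands for the common value of all φ_j with 1 ≤ j < ε.
    have hcases : ∀ g ≠ 0, (intFam (cycFamily α e ε)).count g =
        if g ∈ cycClass α ε 0 then phi α e ε 0 else phi α e ε 1 := by
      intro g hg
      split_ifs with hS
      · exact hcount hS
      · obtain ⟨j, hjε, hj⟩ := exists_mem_cycClass hα hε0 hεα hg
        have hj0 : j ≠ 0 := by rintro rfl; exact hS hj
        rw [hcount hj]
        by_cases hj1 : j = 1
        · rw [hj1]
        · exact hphi j (Finset.mem_Icc.2 (by omega)) 1 (Finset.mem_Icc.2 (by omega)) hj1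
    have hphi01 := hagree hcases
    simp only [← hphi01, ite_self] at hcases
    generalize phi α e ε 0 = c at hcases
    have hint : intFam (cycFamily α e ε) = c • (star F).val := by
      ext g
      rw [count_nsmul_star]
      split_ifs with hg
      · rw [hg, count_zero_intFam]
      · exact hcases g hg
    have hfcard : ∀ i, (cycFamily α e ε i).card = f := by
      intro i
      rw [cycFamily, card_cycClass _ he0 he, hord,
        Nat.mul_div_cancel_left _ (Nat.pos_of_ne_zero he0)]
    -- Count internal differences: m f (f - 1) = c(q - 1) = c ε m f.
    have hfc : f = c * ε + 1 := by
      have h := congrArg Multiset.card hint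
      rw [Multiset.card_nsmul, Finset.card_val, card_star, hF, hq, Nat.add_sub_cancel, intFam,
        Multiset.card_sum] at h
      simp only [card_intDiff, hfcard, Finset.sum_const, Finset.card_univ, Fintype.card_fin,
        smul_eq_mul, hem] at h
      obtain ⟨f', rfl⟩ := Nat.exists_eq_add_one.2 hf0
      rw [← Nat.sub_one_mul, Nat.add_sub_cancel, hm] at h
      have h' : f' * (m * (f' + 1)) = (c * ε) * (m * (f' + 1)) := by linear_combination h
      rw [Nat.eq_of_mul_eq_mul_right (Nat.mul_pos hm0 hf0) h']
    have hclam : c ≤ lam := by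
      rw [← hsum 1 one_ne_zero, hcases 1 one_ne_zero]
      exact Nat.le_add_right _ _
    obtain ⟨d, rfl⟩ := Nat.exists_eq_add_of_le hclam
    have hext : extFam (cycFamily α e ε) = d • (star F).val := by
      have h := intFam_add_extFam _ hdisj
      rw [hunion, hDS.diff, hint, add_smul] at h
      exact add_left_cancel h
    have hdε : (e - ε) * f = ε ^ 2 * d := by
      obtain ⟨m', rfl⟩ := Nat.exists_eq_add_one.2 hm0
      rw [hm, mul_add, mul_one, Nat.add_sub_cancel]
      have : m' * f = d * ε := by
        have := hk1
        rw [add_mul, one_mul, add_mul] at this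
        omega
      linear_combination ε * this
    have hfc' : f - 1 = ε * c := by rw [hfc, Nat.add_sub_cancel, mul_comm]
    refine ⟨⟨⟨c, hfc'⟩, hF, hfcard, hdisj, ?_⟩, ⟨d, hdε⟩, hF, hfcard, hdisj, ?_⟩
    · rw [hfc', Nat.mul_div_cancel_left _ (by omega), hint]
    · rw [hdε, Nat.mul_div_cancel_left _ (by positivity), hext]
  · rintro n k a b ⟨h, hne⟩
    exact hne (hagree (hdpdf h))
  · rintro n k a b ⟨h, hne⟩
    have h1 := hsum 1 one_ne_zero
    have h2 := hsum _ (Units.ne_zero (α ^ 1))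
    have hα1 := hpow (j := 1) (Finset.mem_Icc.2 (by omega))
    rw [hepdf h _ one_ne_zero, if_pos (one_mem_cycClass α ε)] at h1
    rw [hepdf h _ (Units.ne_zero _), if_neg hα1] at h2
    -- The truncated subtraction is exact: `h1` and `h2` give a ≤ λ and b ≤ λ.
    have hab : lam - a = lam - b := by
      refine hagree fun g hg => ?_
      have := hsum g hg
      rw [hepdf h g hg] at this
      split_ifs at this ⊢ <;> omega
    omega
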